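/- Let $A$ be a finite alphabet, let $\widetilde A=A\cup A^{-1}$, and let $F_A$ be the free group on $A$. For a finite set $X$ of reduced words over $\widetilde A$, the flower automaton $\mathcal F(X)$ has a basepoint $q_0$ and, for each $x\in X$, a closed path at $q_0$ labelled $x$, with new distinct intermediate vertices, together with all inverse edges ($(q,a^{-1},p)$ is the inverse of $(p,a,q)$). A folding of an automaton identifies two distinct edges $(p,a,q)$, $(p,a,r)$, where $a\in\widetilde A$ (hence also $q$ with $r$), and their inverses. For a finitely generated subgroup $H\le F_A$, the Stallings automaton $\mathcal S(H)$ is a deterministic trim automaton obtained, up to isomorphism, from $\mathcal F(X)$ by finitely many foldings, for some finite set $X$ of reduced words that generates $H$. A spanning tree $T$ of $\mathcal S(H)$, where $\mathcal S(H)$ has $m$ vertices, consists of $m-1$ edges and their inverses which together connect all the vertices; $g_p$ denotes the label of the shortest path contained in $T$ from $q_0$ to the vertex $p$. (1) Let $H\le F_A$ be finitely generated. Then $\mathcal S(H)$ exists, and every Stallings automaton $\mathcal S(H)$ of $H$ (for whatever choice of $X$ and of the foldings) has a spanning tree. For every spanning tree $T$ of $\mathcal S(H)$, with $E_+$ the set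 of edges of $\mathcal S(H)$ labelled by letters of $A$, the elements $g_p a g_q^{-1}\in F_A$, for $(p,a,q)\in E_+\setminus T$, are pairwise distinct, and $H$ is free with basis $$Y=\{\,g_p a g_q^{-1} \mid (p,a,q)\in E_+\setminus T\,\}.$$ (2) (Effective Nielsen–Schreier theorem for finitely generated subgroups.) There is a computable function that maps every finite list of words over $\widetilde A$ to a finite list of pairwise distinct reduced words that represent a basis of the subgroup of $F_A$ generated by the given words; in particular this subgroup is free. -/

import Mathlib

universe u

namespace Stallings

/-- A letter of the involutive alphabet `Ã = A ∪ A⁻¹`: `(a, true)` is the letter `a` and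
`(a, false)` is its formal inverse (the convention of `FreeGroup`). -/
abbrev Letter (A : Type u) : Type u := A × Bool

/-- Words over the involutive alphabet. -/
abbrev Word (A : Type u) : Type u := List (Letter A)

/-- The involution `a ↦ a⁻¹` on letters. -/
def Letter.inv {A : Type u} (a : Letter A) : Letter A := (a.1, !a.2)

/-- Labelled edges `(p, a, q)` on a vertex set `V`. -/
abbrev LEdge (A V : Type u) : Type u := V × Letter A × V

/-- `IsPath E p w q`: the word `w` labels a path from `p` to `q` using edges from `E`. -/
inductive IsPath {A V : Type u} (E : Set (LEdge A V)) : V → Word A → V → Prop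
  | nil (p : V) : IsPath E p [] p
  | cons {p q r : V} {a : Letter A} {w : Word A} :
      (p, a, q) ∈ E → IsPath E q w r → IsPath E p (a :: w) r

/-- An involutive automaton over `Ã` with a basepoint (the initial state, which is also the only
final state). -/
structure InvAutomaton (A : Type u) where
  /-- the vertices -/
  V : Type u
  /-- the basepoint -/
  base : V
  /-- the edges -/
  edges : Set (LEdge A V)
  /-- with every edge `(p, a, q)` also `(q, a⁻¹, p)` is an edge -/
  involutive : ∀ p a q, (p, a, q) ∈ edges → (q, Letter.inv a, p) ∈ edges

namespace InvAutomaton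

variable {A : Type u}

/-- No two distinct edges leave the same vertex with the same label. -/
def Deterministic (S : InvAutomaton A) : Prop :=
  ∀ p a q r, (p, a, q) ∈ S.edges → (p, a, r) ∈ S.edges → q = r

/-- Every vertex lies on a successful path, that is, on a path from the basepoint to itself. -/
def Trim (S : InvAutomaton A) : Prop :=
  ∀ p, ∃ v w, IsPath S.edges S.base v p ∧ IsPath S.edges p w S.base

/-- Inverse automata (with a basepoint). -/
def IsInverse (S : InvAutomaton A) : Prop :=
  S.Deterministic ∧ S.Trim

/-- The vertices of the flower automaton: `none` is the basepoint, and `some (x, i)` with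
`0 < i < |x|` is the `i`-th vertex on the petal of `x ∈ X`. -/
abbrev FlowerVertex (X : Set (Word A)) : Type u :=
  Option {v : Word A × ℕ // v.1 ∈ X ∧ 0 < v.2 ∧ v.2 < v.1.length}

open Classical in
/-- The `i`-th vertex on the petal of `x`; the first (`i = 0`) and the last (`i = |x|`) vertex
are the basepoint. -/
noncomputable def petalVertex (X : Set (Word A)) (x : Word A) (i : ℕ) : FlowerVertex X :=
  if h : x ∈ X ∧ 0 < i ∧ i < x.length then some ⟨(x, i), h⟩ else none

/-- The flower automaton of `X`: a petal labelled `x` is glued to the basepoint for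
every `x ∈ X`, together with all inverse edges. -/
noncomputable def flower (X : Set (Word A)) : InvAutomaton A where
  V := FlowerVertex X
  base := none
  edges := {e | ∃ x ∈ X, ∃ (i : ℕ) (hi : i < x.length),
    e = (petalVertex X x i, x[i], petalVertex X x (i + 1)) ∨
    e = (petalVertex X x (i + 1), Letter.inv x[i], petalVertex X x i)}
  involutive := by
    rintro p a q ⟨x, hx, i, hi, h | h⟩
    · obtain ⟨rfl, rfl, rfl⟩ := by simpa only [Prod.mk.injEq] using h
      exact ⟨x, hx, i, hi, Or.inr rfl⟩
    · obtain ⟨rfl, rfl, rfl⟩ := by simpa only [Prod.mk.injEq] using h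
      exact ⟨x, hx, i, hi, Or.inl (by simp [Letter.inv])⟩

/-- The image of a labelled edge under a map of vertices. -/
def mapEdge {V W : Type u} (φ : V → W) (e : LEdge A V) : LEdge A W := (φ e.1, e.2.1, φ e.2.2)

/-- `S'` is obtained (up to isomorphism) from `S` by one Stallings folding: two distinct edges
`(p, a, q)` and `(p, a, r)` are identified, and so are their inverses; equivalently, `S'` is the
quotient of `S` in which precisely the vertices `q` and `r` are identified. -/
def Folding (S S' : InvAutomaton A) : Prop :=
  ∃ p a q r, (p, a, q) ∈ S.edges ∧ (p, a, r) ∈ S.edges ∧ q ≠ r ∧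
    ∃ φ : S.V → S'.V, Function.Surjective φ ∧
      (∀ x y, φ x = φ y ↔ x = y ∨ (x = q ∧ y = r) ∨ (x = r ∧ y = q)) ∧
      φ S.base = S'.base ∧ S'.edges = mapEdge φ '' S.edges

/-- Isomorphism of automata. -/
def Isomorphic (S S' : InvAutomaton A) : Prop :=
  ∃ φ : S.V ≃ S'.V, φ S.base = S'.base ∧ S'.edges = mapEdge φ '' S.edges

/-- `S` is the Stallings automaton of `X`: an inverse automaton obtained from the flower automaton
of `X` by a finite sequence of foldings. -/
def IsStallingsOfWords (S : InvAutomaton A) (X : Set (Word A)) : Prop :=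
  S.IsInverse ∧ ∃ S₀, Relation.ReflTransGen Folding (flower X) S₀ ∧ Isomorphic S₀ S

/-- `S` is the Stallings automaton of the subgroup `H`: it is the Stallings automaton of some
finite set of reduced words that generates `H`. -/
def IsStallingsOf (S : InvAutomaton A) (H : Subgroup (FreeGroup A)) : Prop :=
  ∃ X : Set (Word A), X.Finite ∧ (∀ x ∈ X, FreeGroup.IsReduced x) ∧
    Subgroup.closure (FreeGroup.mk '' X) = H ∧ S.IsStallingsOfWords X

/-- The positively labelled edges in a set of edges. -/
def positive {V : Type u} (E : Set (LEdge A V)) : Set (LEdge A V) := {e ∈ E | e.2.1.2 = true}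

/-- A spanning tree of an automaton with `m` vertices: `m - 1` edges and their inverses, which
together connect all the vertices. (Of an edge and its inverse exactly one is
positively labelled, so the positively labelled edges are counted.) -/
structure IsSpanningTree (S : InvAutomaton A) (T : Set (LEdge A S.V)) : Prop where
  subset : T ⊆ S.edges
  symm : ∀ p a q, (p, a, q) ∈ T → (q, Letter.inv a, p) ∈ T
  card : (positive T).encard + 1 = ENat.card S.V
  connected : ∀ p q, ∃ w, IsPath T p w q

/-- `w` labels a shortest path contained in `T` from the basepoint to `p`. -/
def IsGeodesic (S : InvAutomaton A) (T : Set (LEdge A S.V)) (p : S.V) (w : Word A) : Prop :=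
  IsPath T S.base w p ∧ ∀ v, IsPath T S.base v p → w.length ≤ v.length

/-- The element `g_p a g_q⁻¹` of the free group attached to an edge `(p, a, q)`. -/
def edgeElement {V : Type u} (g : V → Word A) (e : LEdge A V) : FreeGroup A :=
  FreeGroup.mk (g e.1) * FreeGroup.mk [e.2.1] * (FreeGroup.mk (g e.2.2))⁻¹

end InvAutomaton

/-- The subgroup `H` is free with basis the set `Y`. -/
def IsFreeWithBasis {G : Type u} [Group G] (H : Subgroup G) (Y : Set G) : Prop :=
  ∃ b : FreeGroupBasis Y H, ∀ y : Y, (b y : G) = y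

end Stallings

namespace Stallings

/-! Existence: each folding of a finite automaton loses a vertex, so folding the flower automaton
ends in a deterministic one. What survives every folding is recorded in `Presents`: the automaton is
finite and connected, reads all of `X` as loops, and carries a potential on its vertices which
forces the labels of loops at the basepoint to lie in `H`. A breadth-first tree then gives a
spanning tree.

Generation: each `g_p a g_q⁻¹` is the label of a loop, hence lies in `H`. Conversely, the product
along a loop telescopes into such elements and their inverses, and tree edges contribute 1. The
latter needs that tree geodesics to neighbouring vertices differ by one letter; as a spanning tree
is defined by its number of edges, this comes from counting (`ascending_spec`).

Freeness (`lift_edgeElement_injective`): by determinism each letter acts on the finite vertex set as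
a partial injection, which extends to a permutation. Letting the permutations also multiply a second
coordinate in the free group on the non-tree edges yields an action of `F_A` from which a word in
these generators can be recovered.

Computability: the basis is found by unbounded search. A candidate consists of an inverse automaton
whose vertices are named by reduced words (`IsSchreierData`) together with factorizations proving
that its elements and the given words generate the same subgroup. Checking a candidate is primitive
recursive, every accepted candidate gives a basis, and the Stallings automaton shows that one
exists. -/

theorem Letter.inv_inv {A : Type u} (a : Letter A) : Letter.inv (Letter.inv a) = a := by
  simp [Letter.inv]

theorem mk_cons {A : Type u} (a : Letter A) (w : Word A) :
    FreeGroup.mk (a :: w) = FreeGroup.mk [a] * FreeGroup.mk w := by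
  simp [FreeGroup.mul_mk]

theorem mk_inv_singleton {A : Type u} (a : Letter A) :
    FreeGroup.mk [Letter.inv a] = (FreeGroup.mk [a])⁻¹ := by
  simp [FreeGroup.inv_mk, FreeGroup.invRev, Letter.inv]

/-! ### Paths and telescoping products -/

namespace IsPath

variable {A V W : Type u} {E E' : Set (LEdge A V)} {p q r : V} {v w : Word A} {a : Letter A}

theorem nil_iff : IsPath E p [] q ↔ p = q :=
  ⟨fun h => by cases h; rfl, fun h => h ▸ IsPath.nil p⟩

theorem cons_iff : IsPath E p (a :: w) r ↔ ∃ q, (p, a, q) ∈ E ∧ IsPath E q w r :=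
  ⟨fun h => by cases h with | cons h₁ h₂ => exact ⟨_, h₁, h₂⟩, fun ⟨_, h₁, h₂⟩ => .cons h₁ h₂⟩

theorem append_iff : IsPath E p (v ++ w) r ↔ ∃ q, IsPath E p v q ∧ IsPath E q w r := by
  induction v generalizing p with
  | nil => simp [nil_iff]
  | cons a v ih =>
    simp only [List.cons_append, cons_iff, ih]
    constructor
    · rintro ⟨s, h, q, h₁, h₂⟩
      exact ⟨q, ⟨s, h, h₁⟩, h₂⟩
    · rintro ⟨q, ⟨s, h, h₁⟩, h₂⟩
      exact ⟨s, h, q, h₁, h₂⟩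

theorem append (h : IsPath E p v q) (h' : IsPath E q w r) : IsPath E p (v ++ w) r :=
  append_iff.2 ⟨q, h, h'⟩

theorem single_iff : IsPath E p [a] q ↔ (p, a, q) ∈ E := by
  simp [cons_iff, nil_iff]

theorem concat_iff : IsPath E p (w ++ [a]) r ↔ ∃ q, IsPath E p w q ∧ (q, a, r) ∈ E := by
  simp only [append_iff, single_iff]

theorem mono (h : IsPath E p w q) (hE : E ⊆ E') : IsPath E' p w q := by
  induction h with
  | nil => exact .nil _
  | cons h _ ih => exact .cons (hE h) ih

theorem map (φ : V → W) (h : IsPath E p w q) :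
    IsPath (InvAutomaton.mapEdge φ '' E) (φ p) w (φ q) := by
  induction h with
  | nil => exact .nil _
  | cons h _ ih => exact .cons ⟨_, h, rfl⟩ ih

theorem reverse (hE : ∀ p a q, (p, a, q) ∈ E → (q, Letter.inv a, p) ∈ E) (h : IsPath E p w q) :
    IsPath E q (FreeGroup.invRev w) p := by
  induction h with
  | nil => exact .nil _
  | cons h _ ih =>
    rw [FreeGroup.invRev_cons]
    exact ih.append (single_iff.2 (hE _ _ _ h))

/-- Along every path, an element that is constrained edge by edge to a subgroup telescopes. -/
theorem telescope {G : Subgroup (FreeGroup A)} (P : V → FreeGroup A)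
    (hP : ∀ p a q, (p, a, q) ∈ E → P p * FreeGroup.mk [a] * (P q)⁻¹ ∈ G) (h : IsPath E p w q) :
    P p * FreeGroup.mk w * (P q)⁻¹ ∈ G := by
  induction h with
  | nil => simp [← FreeGroup.one_eq_mk, G.one_mem]
  | @cons p q r a w h _ ih =>
    have := G.mul_mem (hP _ _ _ h) ih
    rw [mk_cons]
    convert this using 1
    group

end IsPath

/-! ### Freeness via a permutation action -/

/-- A relation on a finite type that is functional in both directions extends to a permutation. -/
theorem exists_perm_of_biunique {V : Type u} [Finite V] (R : V → V → Prop)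
    (h₁ : ∀ p q r, R p q → R p r → q = r) (h₂ : ∀ p q r, R p r → R q r → p = q) :
    ∃ σ : Equiv.Perm V, ∀ p q, R p q → σ p = q := by
  classical
  have := Fintype.ofFinite V
  let f : {p // ∃ q, R p q} → {q // ∃ p, R p q} := fun p => ⟨p.2.choose, p.1, p.2.choose_spec⟩
  have hf : Function.Bijective f := by
    constructor
    · rintro ⟨p, hp⟩ ⟨q, hq⟩ h
      have h' : hp.choose = hq.choose := congrArg Subtype.val h
      exact Subtype.ext (h₂ _ _ _ hp.choose_spec (h' ▸ hq.choose_spec))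
    · rintro ⟨q, p, h⟩
      exact ⟨⟨p, q, h⟩, Subtype.ext (h₁ p _ _ (Exists.choose_spec (⟨q, h⟩ : ∃ q, R p q)) h)⟩
  refine ⟨(Equiv.ofBijective f hf).extendSubtype, fun p q h => ?_⟩
  rw [Equiv.extendSubtype_apply_of_mem _ p ⟨q, h⟩]
  exact h₁ p _ _ (Exists.choose_spec (⟨q, h⟩ : ∃ q, R p q)) h

open InvAutomaton

/-- In a finite inverse automaton, the elements `g_p a g_q⁻¹` attached to the positive edges outside
a set `T` of edges through which every vertex is reachable are free. -/
theorem lift_edgeElement_injective {A V : Type u} [Finite V] {E T : Set (LEdge A V)} {b : V}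
    (hdet : ∀ p a q r, (p, a, q) ∈ E → (p, a, r) ∈ E → q = r)
    (hinv : ∀ p a q, (p, a, q) ∈ E → (q, Letter.inv a, p) ∈ E) (hT : T ⊆ E)
    (hTinv : ∀ p a q, (p, a, q) ∈ T → (q, Letter.inv a, p) ∈ T)
    (g : V → Word A) (hg : ∀ p, IsPath T b (g p) p) :
    Function.Injective
      (FreeGroup.lift fun e : ↥(positive E \ T) => edgeElement g (e : LEdge A V)) := by
  classical
  set I := ↥(positive E \ T)
  have hperm : ∀ a : A, ∃ σ : Equiv.Perm V, ∀ q p, (p, (a, true), q) ∈ E → σ q = p := fun a =>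
    exists_perm_of_biunique (fun q p => (p, (a, true), q) ∈ E)
      (fun q p r h h' => hdet _ _ _ _ (hinv _ _ _ h) (hinv _ _ _ h'))
      (fun p q r h h' => hdet _ _ _ _ h h')
  choose σ hσ using hperm
  -- Permutations compose from right to left, so the last letter of a word acts first and `σ a`
  -- crosses edges backwards. The second coordinate picks up the generator of the crossed edge if
  -- that edge lies outside `T`, and nothing for tree edges or for values that exist only through
  -- the extension to a permutation.
  let ε : A → V → FreeGroup I := fun a q =>
    if h : (σ a q, (a, true), q) ∈ positive E \ T then FreeGroup.of ⟨_, h⟩ else 1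
  let τ : A → Equiv.Perm (V × FreeGroup I) := fun a =>
    Equiv.prodShear (σ a) fun q => Equiv.mulLeft (ε a q)
  have hτ : ∀ a q x, τ a (q, x) = (σ a q, ε a q * x) := fun a q x => rfl
  let ρ : FreeGroup A →* Equiv.Perm (V × FreeGroup I) := FreeGroup.lift τ
  have hρof : ∀ a, ρ (FreeGroup.mk [(a, true)]) = τ a := fun a => by
    rw [← FreeGroup.of.eq_1]; exact FreeGroup.lift_apply_of
  have hρT : ∀ p a q x, (p, a, q) ∈ T → ρ (FreeGroup.mk [a]) (q, x) = (p, x) := by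
    have key : ∀ p a q x, (p, (a, true), q) ∈ T → τ a (q, x) = (p, x) := by
      intro p a q x h
      have hs := hσ _ _ _ (hT h)
      rw [hτ, hs]
      have : ε a q = 1 := dif_neg (by rw [hs]; exact fun h' => h'.2 h)
      rw [this, one_mul]
    rintro p ⟨a, _ | _⟩ q x h
    · have h' := key _ _ _ x (hTinv _ _ _ h)
      have : FreeGroup.mk [(a, false)] = (FreeGroup.mk [(a, true)] : FreeGroup A)⁻¹ :=
        mk_inv_singleton (a, true)
      rw [this, map_inv, hρof, Equiv.Perm.inv_eq_iff_eq, h']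
    · rw [hρof, key _ _ _ _ h]
  have hρpath : ∀ p w q, IsPath T p w q → ∀ x, ρ (FreeGroup.mk w) (q, x) = (p, x) := by
    intro p w q h
    induction h with
    | nil => intro x; simp [← FreeGroup.one_eq_mk]
    | cons h _ ih =>
      intro x
      rw [mk_cons, map_mul, Equiv.Perm.mul_apply, ih, hρT _ _ _ _ h]
  have hρe : ∀ (e : I) x, ρ (edgeElement g (e : LEdge A V)) (b, x) = (b, FreeGroup.of e * x) := by
    rintro ⟨⟨p, ⟨a, s⟩, q⟩, ⟨hE, hs⟩, hnT⟩ x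
    obtain rfl : s = true := hs
    have hq : ((ρ (FreeGroup.mk (g q)))⁻¹) (b, x) = (q, x) := by
      rw [Equiv.Perm.inv_eq_iff_eq, hρpath _ _ _ (hg q)]
    have hs' := hσ _ _ _ hE
    have hε : ε a q = FreeGroup.of ⟨(p, (a, true), q), ⟨hE, rfl⟩, hnT⟩ := by
      subst hs'
      exact dif_pos _
    simp only [edgeElement, map_mul, map_inv, Equiv.Perm.mul_apply, hq]
    rw [hρof, hτ, hs', hε, hρpath _ _ _ (hg p)]
  have hρw : ∀ y x : FreeGroup I,
      ρ (FreeGroup.lift (fun e : I => edgeElement g (e : LEdge A V)) y) (b, x) = (b, y * x) := by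
    intro y
    induction y using FreeGroup.induction_on with
    | C1 => intro x; simp
    | of e => intro x; rw [FreeGroup.lift_apply_of, hρe]
    | inv_of e ih =>
      intro x
      rw [map_inv, map_inv, Equiv.Perm.inv_eq_iff_eq, ih]
      simp
    | mul y z hy hz =>
      intro x
      rw [map_mul, map_mul, Equiv.Perm.mul_apply, hz, hy, mul_assoc]
  intro y z h
  -- The second coordinate of the image of `(b, 1)` is the word itself.
  have hy := hρw y 1
  rw [h, hρw z 1] at hy
  simpa using (congrArg Prod.snd hy).symm

/-- A family whose lift to the free group is injective is a basis of the subgroup generated. -/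
theorem isFreeWithBasis_of_lift_injective {G ι : Type u} [Group G] (f : ι → G)
    (hf : Function.Injective (FreeGroup.lift f)) {H : Subgroup G}
    (hH : Subgroup.closure (Set.range f) = H) :
    Function.Injective f ∧ IsFreeWithBasis H (Set.range f) := by
  have hfi : Function.Injective f := by
    intro i j h
    apply FreeGroup.of_injective
    apply hf
    simpa using h
  refine ⟨hfi, ?_⟩
  have hr : (FreeGroup.lift f).range = H := by rw [FreeGroup.range_lift_eq_closure, hH]
  let e : H ≃* FreeGroup ι :=
    ((MonoidHom.ofInjective hf).trans (MulEquiv.subgroupCongr hr)).symm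
  let b : FreeGroupBasis ι H := .ofRepr e
  refine ⟨b.reindex (Equiv.ofInjective f hfi), ?_⟩
  rintro ⟨_, i, rfl⟩
  have hi : (Equiv.ofInjective f hfi).symm ⟨f i, i, rfl⟩ = i := by
    rw [Equiv.symm_apply_eq]; rfl
  rw [FreeGroupBasis.reindex_apply, hi]
  change FreeGroup.lift f (FreeGroup.of i) = f i
  exact FreeGroup.lift_apply_of

/-! ### Existence of Stallings automata and the invariant of foldings -/

namespace InvAutomaton

variable {A : Type u}

/-- `S` is a finite connected automaton reading all words of `X`, and the labels of its
closed paths at the basepoint lie in `H`; the latter is witnessed by elements attached to the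
vertices, whose right cosets of `H` are compatible with the edges. -/
structure Presents (S : InvAutomaton A) (X : Set (Word A)) (H : Subgroup (FreeGroup A)) :
    Prop where
  finite : Finite S.V
  reach : ∀ p, ∃ w, IsPath S.edges S.base w p
  loops : ∀ x ∈ X, IsPath S.edges S.base x S.base
  potential : ∃ P : S.V → FreeGroup A, P S.base ∈ H ∧
    ∀ p a q, (p, a, q) ∈ S.edges → P p * FreeGroup.mk [a] * (P q)⁻¹ ∈ H

namespace Presents

variable {S S' : InvAutomaton A} {X : Set (Word A)} {H : Subgroup (FreeGroup A)}

theorem trim (h : S.Presents X H) : S.Trim := fun p => by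
  obtain ⟨w, hw⟩ := h.reach p
  exact ⟨w, _, hw, hw.reverse S.involutive⟩

theorem mk_mem (h : S.Presents X H) {w : Word A} (hw : IsPath S.edges S.base w S.base) :
    FreeGroup.mk w ∈ H := by
  obtain ⟨P, hb, hP⟩ := h.potential
  have := hw.telescope P hP
  rwa [H.mul_mem_cancel_right (H.inv_mem hb), H.mul_mem_cancel_left hb] at this

/-- The potential matters only through the cosets `H * P x`. By `hH` identified vertices have the
same coset, so the values at arbitrarily chosen preimages form a potential on the quotient. -/
theorem quotient (h : S.Presents X H) (φ : S.V → S'.V) (hφ : Function.Surjective φ)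
    (hb : φ S.base = S'.base) (hE : S'.edges = mapEdge φ '' S.edges)
    (hH : ∀ P : S.V → FreeGroup A,
      (∀ p a q, (p, a, q) ∈ S.edges → P p * FreeGroup.mk [a] * (P q)⁻¹ ∈ H) →
      ∀ x y, φ x = φ y → P x * (P y)⁻¹ ∈ H) : S'.Presents X H where
  finite := have := h.finite; Finite.of_surjective φ hφ
  reach p := by
    obtain ⟨p, rfl⟩ := hφ p
    obtain ⟨w, hw⟩ := h.reach p
    exact ⟨w, hb ▸ hE ▸ hw.map φ⟩
  loops x hx := by
    have := (h.loops x hx).map φ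
    rwa [hb, ← hE] at this
  potential := by
    obtain ⟨P, hPb, hP⟩ := h.potential
    have key : ∀ x, P (Function.surjInv hφ (φ x)) * (P x)⁻¹ ∈ H := fun x =>
      hH P hP _ _ (Function.surjInv_eq hφ _)
    refine ⟨fun y => P (Function.surjInv hφ y), ?_, ?_⟩
    · have := H.mul_mem (key S.base) hPb
      rwa [hb, inv_mul_cancel_right] at this
    · intro p a q hpq
      rw [hE] at hpq
      obtain ⟨⟨p, a, q⟩, hpq, he⟩ := hpq
      obtain ⟨rfl, rfl, rfl⟩ := by simpa only [mapEdge, Prod.mk.injEq] using he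
      convert H.mul_mem (H.mul_mem (key p) (hP _ _ _ hpq)) (H.inv_mem (key q)) using 1
      group

/-- Both `P p * a * (P q)⁻¹` and `P p * a * (P r)⁻¹` lie in `H`; the inverse of the first times the
second is `P q * (P r)⁻¹`. -/
theorem folding (h : S.Presents X H) (hf : Folding S S') : S'.Presents X H := by
  obtain ⟨p, a, q, r, hq, hr, -, φ, hφ, hφ', hb, hE⟩ := hf
  refine h.quotient φ hφ hb hE fun P hP x y hxy => ?_
  have key : P q * (P r)⁻¹ ∈ H := by
    convert H.mul_mem (H.inv_mem (hP _ _ _ hq)) (hP _ _ _ hr) using 1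
    group
  rcases (hφ' x y).1 hxy with rfl | ⟨rfl, rfl⟩ | ⟨rfl, rfl⟩
  · simp [H.one_mem]
  · exact key
  · simpa using H.inv_mem key

theorem foldings (h : S.Presents X H) (hf : Relation.ReflTransGen Folding S S') :
    S'.Presents X H := by
  induction hf with
  | refl => exact h
  | tail _ hf ih => exact ih.folding hf

theorem isomorphic (h : S.Presents X H) (hf : Isomorphic S S') : S'.Presents X H := by
  obtain ⟨φ, hb, hE⟩ := hf
  refine h.quotient φ φ.surjective hb hE fun P hP x y hxy => ?_
  rw [φ.injective hxy]
  simp [H.one_mem]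

end Presents

theorem petalVertex_zero (X : Set (Word A)) (x : Word A) : petalVertex X x 0 = none := by
  simp [petalVertex]

theorem petalVertex_length (X : Set (Word A)) (x : Word A) :
    petalVertex X x x.length = none := by
  simp [petalVertex]

theorem isPath_petal {X : Set (Word A)} {x : Word A} (hx : x ∈ X) (i : ℕ) (hi : i ≤ x.length) :
    IsPath (flower X).edges (flower X).base (x.take i) (petalVertex X x i) := by
  induction i with
  | zero => rw [petalVertex_zero]; exact .nil _
  | succ i ih =>
    rw [← List.take_append_getElem (l := x) (i := i) (by omega)]
    exact (ih (by omega)).append (IsPath.single_iff.2 ⟨x, hx, i, hi, Or.inl rfl⟩)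

/-- The potential at the `i`-th vertex of a petal is the prefix of length `i`. At the end of the
petal the basepoint has the value 1 instead of `x`, which is harmless because `x` represents an
element of `H`. -/
theorem flower_presents {X : Set (Word A)} (hX : X.Finite) {H : Subgroup (FreeGroup A)}
    (hH : Subgroup.closure (FreeGroup.mk '' X) = H) : (flower X).Presents X H where
  finite := by
    have hf : {v : Word A × ℕ | v.1 ∈ X ∧ 0 < v.2 ∧ v.2 < v.1.length}.Finite := by
      refine (hX.biUnion (t := fun x => (fun i => (x, i)) '' Set.Iio x.length)
        fun x _ => (Set.finite_Iio _).image _).subset ?_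
      rintro ⟨x, i⟩ ⟨hx, -, hi⟩
      exact Set.mem_biUnion hx ⟨i, hi, rfl⟩
    have := hf.to_subtype
    exact inferInstanceAs (Finite (Option {v : Word A × ℕ | _}))
  reach p := by
    rcases p with _ | ⟨⟨x, i⟩, h⟩
    · exact ⟨[], .nil _⟩
    · have := isPath_petal h.1 i h.2.2.le
      rw [petalVertex, dif_pos h] at this
      exact ⟨_, this⟩
  loops x hx := by
    have := isPath_petal hx x.length le_rfl
    rwa [petalVertex_length, List.take_length] at this
  potential := by
    let P : (flower X).V → FreeGroup A := fun v =>
      v.elim 1 fun v => FreeGroup.mk (v.1.1.take v.1.2)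
    have hP : ∀ x ∈ X, ∀ i ≤ x.length,
        P (petalVertex X x i) * (FreeGroup.mk (x.take i))⁻¹ ∈ H := by
      intro x hx i hi
      by_cases h : x ∈ X ∧ 0 < i ∧ i < x.length
      · rw [petalVertex, dif_pos h]
        change FreeGroup.mk (x.take i) * (FreeGroup.mk (x.take i))⁻¹ ∈ H
        rw [mul_inv_cancel]
        exact H.one_mem
      · rw [petalVertex, dif_neg h]
        rcases Nat.eq_zero_or_pos i with rfl | h0
        · simp [P, ← FreeGroup.one_eq_mk, H.one_mem]
        · obtain rfl : i = x.length := by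
            by_contra hne
            exact h ⟨hx, h0, by omega⟩
          simp only [P, Option.elim_none, one_mul, List.take_length]
          rw [← hH]
          exact Subgroup.inv_mem _ (Subgroup.subset_closure ⟨x, hx, rfl⟩)
    have key : ∀ x ∈ X, ∀ (i : ℕ) (hi : i < x.length),
        P (petalVertex X x i) * FreeGroup.mk [x[i]] * (P (petalVertex X x (i + 1)))⁻¹ ∈ H := by
      intro x hx i hi
      convert H.mul_mem (hP x hx i hi.le) (H.inv_mem (hP x hx (i + 1) hi)) using 1
      rw [← List.take_append_getElem (l := x) (i := i) hi, ← FreeGroup.mul_mk]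
      group
    refine ⟨P, H.one_mem, ?_⟩
    rintro p a q ⟨x, hx, i, hi, h | h⟩
    · obtain ⟨rfl, rfl, rfl⟩ := by simpa only [Prod.mk.injEq] using h
      exact key x hx i hi
    · obtain ⟨rfl, rfl, rfl⟩ := by simpa only [Prod.mk.injEq] using h
      rw [mk_inv_singleton]
      convert H.inv_mem (key x hx i hi) using 1
      group

theorem IsStallingsOf.presents {S : InvAutomaton A} {H : Subgroup (FreeGroup A)}
    (h : S.IsStallingsOf H) : S.IsInverse ∧ ∃ X : Set (Word A), S.Presents X H ∧
      Subgroup.closure (FreeGroup.mk '' X) = H := by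
  obtain ⟨X, hX, -, hH, hS, S₀, hf, hi⟩ := h
  exact ⟨hS, X, ((flower_presents hX hH).foldings hf).isomorphic hi, hH⟩

/-- A non-deterministic finite automaton can be folded, and this decreases the number of
vertices. -/
theorem exists_folding (S : InvAutomaton A) [Finite S.V] (h : ¬ S.Deterministic) :
    ∃ S' : InvAutomaton A, Folding S S' ∧ Nat.card S'.V < Nat.card S.V := by
  classical
  simp only [Deterministic, not_forall] at h
  obtain ⟨p, a, q, r, hq, hr, hne⟩ := h
  -- The quotient is realised by deleting `r` and redirecting it to `q`, which makes the drop in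
  -- cardinality evident.
  let φ : S.V → {v : S.V // v ≠ r} := fun v => if h : v = r then ⟨q, hne⟩ else ⟨v, h⟩
  have hφr : φ r = ⟨q, hne⟩ := dif_pos rfl
  have hφ : ∀ v (h : v ≠ r), φ v = ⟨v, h⟩ := fun v h => dif_neg h
  refine ⟨⟨{v : S.V // v ≠ r}, φ S.base, mapEdge φ '' S.edges, ?_⟩,
    ⟨p, a, q, r, hq, hr, hne, φ, fun v => ⟨v, hφ _ v.2⟩, ?_, rfl, rfl⟩, ?_⟩
  · rintro _ _ _ ⟨⟨p, a, q⟩, h, he⟩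
    obtain ⟨rfl, rfl, rfl⟩ := by simpa only [mapEdge, Prod.mk.injEq] using he
    exact ⟨_, S.involutive _ _ _ h, rfl⟩
  · intro x y
    by_cases hx : x = r <;> by_cases hy : y = r
    · simp [hx, hy]
    · subst hx
      rw [hφr, hφ y hy, Subtype.mk.injEq]
      grind
    · subst hy
      rw [hφr, hφ x hx, Subtype.mk.injEq]
      grind
    · rw [hφ x hx, hφ y hy, Subtype.mk.injEq]
      grind
  · exact Finite.card_subtype_lt (p := fun v => v ≠ r) (x := r) (by simp)

theorem exists_deterministic_foldings (S : InvAutomaton A) [Finite S.V] :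
    ∃ S' : InvAutomaton A, Relation.ReflTransGen Folding S S' ∧ S'.Deterministic := by
  induction hn : Nat.card S.V using Nat.strong_induction_on generalizing S with
  | _ n ih =>
    by_cases hS : S.Deterministic
    · exact ⟨S, .refl, hS⟩
    · obtain ⟨S₁, hf, hc⟩ := exists_folding S hS
      have : Finite S₁.V := by
        obtain ⟨_, _, _, _, _, _, _, φ, hφ, -⟩ := hf
        exact Finite.of_surjective φ hφ
      obtain ⟨S₂, hf₂, h₂⟩ := ih _ (hn ▸ hc) S₁ rfl
      exact ⟨S₂, .head hf hf₂, h₂⟩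

theorem exists_isStallingsOf {H : Subgroup (FreeGroup A)} (hH : H.FG) :
    ∃ S : InvAutomaton A, S.IsStallingsOf H := by
  classical
  obtain ⟨G, hG⟩ := hH
  have hX : (FreeGroup.toWord '' (G : Set (FreeGroup A))).Finite := G.finite_toSet.image _
  have hcl : Subgroup.closure
      (FreeGroup.mk '' (FreeGroup.toWord '' (G : Set (FreeGroup A)))) = H := by
    rw [Set.image_image]
    simp only [FreeGroup.mk_toWord, Set.image_id', hG]
  have hP := flower_presents hX hcl
  have := hP.finite
  obtain ⟨S, hf, hd⟩ := exists_deterministic_foldings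
    (flower (FreeGroup.toWord '' (G : Set (FreeGroup A))))
  refine ⟨S, _, hX, ?_, hcl, ⟨hd, (hP.foldings hf).trim⟩, S, hf, Equiv.refl _, rfl, ?_⟩
  · rintro _ ⟨x, -, rfl⟩
    exact FreeGroup.isReduced_toWord
  · exact (Set.image_id S.edges).symm

end InvAutomaton

/-! ### Spanning trees, geodesics and the basis -/

/-- The positively labelled one among an edge and its inverse. -/
def LEdge.positivePart {A V : Type u} (e : LEdge A V) : LEdge A V :=
  if e.2.1.2 then e else (e.2.2, Letter.inv e.2.1, e.1)

theorem LEdge.positivePart_eq_or {A V : Type u} (e : LEdge A V) :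
    e.positivePart = e ∨ e.positivePart = (e.2.2, Letter.inv e.2.1, e.1) := by
  unfold positivePart
  split <;> simp

theorem LEdge.positivePart_positive {A V : Type u} (e : LEdge A V) :
    e.positivePart.2.1.2 = true := by
  unfold positivePart
  split <;> simp_all [Letter.inv]

/-- Edges with the same positive part agree up to inversion. -/
theorem LEdge.eq_or_of_positivePart_eq {A V : Type u} {e e' : LEdge A V}
    (h : e.positivePart = e'.positivePart) :
    e = e' ∨ e = (e'.2.2, Letter.inv e'.2.1, e'.1) := by
  obtain ⟨p, a, q⟩ := e
  obtain ⟨p', a', q'⟩ := e'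
  rcases LEdge.positivePart_eq_or (p, a, q) with h₁ | h₁ <;>
  rcases LEdge.positivePart_eq_or (p', a', q') with h₂ | h₂ <;>
  rw [h₁, h₂] at h <;> simp only [Prod.mk.injEq] at h ⊢
  · exact Or.inl h
  · exact Or.inr h
  · obtain ⟨rfl, rfl, rfl⟩ := h
    exact Or.inr ⟨rfl, (Letter.inv_inv _).symm, rfl⟩
  · refine Or.inl ⟨h.2.2, ?_, h.1⟩
    rw [← Letter.inv_inv a, h.2.1, Letter.inv_inv]

theorem exists_geodesic {A V : Type u} {E : Set (LEdge A V)} {b p : V}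
    (h : ∃ w, IsPath E b w p) :
    ∃ w, IsPath E b w p ∧ ∀ v, IsPath E b v p → w.length ≤ v.length := by
  obtain ⟨w, hw, hmin⟩ := (measure List.length).wf.has_min {w | IsPath E b w p} h
  exact ⟨w, hw, fun v hv => not_lt.1 (hmin v hv)⟩

namespace InvAutomaton

variable {A : Type u} {S : InvAutomaton A} {T : Set (LEdge A S.V)} {g : S.V → Word A}

theorem IsGeodesic.base_eq_nil (hg : ∀ p, S.IsGeodesic T p (g p)) : g S.base = [] := by
  have := (hg S.base).2 [] (.nil _)
  simpa using this

/-- A geodesic that does not end at the basepoint is a geodesic followed by an edge. -/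
theorem IsGeodesic.concat (hg : ∀ p, S.IsGeodesic T p (g p)) {u : Word A} {a : Letter A} {p : S.V}
    (hp : S.IsGeodesic T p (u ++ [a])) :
    ∃ q, (q, a, p) ∈ T ∧ S.IsGeodesic T q u ∧ (g p).length = (g q).length + 1 := by
  obtain ⟨q, hu, hq⟩ := IsPath.concat_iff.1 hp.1
  have h₁ := (hg q).2 u hu
  have h₂ := hp.2 _ (IsPath.concat_iff.2 ⟨q, (hg q).1, hq⟩)
  have h₃ := hp.2 _ (hg p).1
  have h₄ := (hg p).2 _ hp.1
  simp only [List.length_append, List.length_singleton] at h₂ h₃ h₄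
  exact ⟨q, hq, ⟨hu, fun v hv => by have := (hg q).2 v hv; omega⟩, by omega⟩

/-- The edges of `T` that lead away from the basepoint. -/
def ascending (T : Set (LEdge A S.V)) (g : S.V → Word A) : Set (LEdge A S.V) :=
  {e ∈ T | (g e.2.2).length = (g e.1).length + 1}

theorem compl_base_subset_target (hg : ∀ p, S.IsGeodesic T p (g p)) :
    {S.base}ᶜ ⊆ (fun e : LEdge A S.V => e.2.2) '' ascending T g := by
  intro p hp
  rcases List.eq_nil_or_concat (g p) with h | ⟨u, a, h⟩
  · have := (hg p).1
    rw [h, IsPath.nil_iff] at this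
    exact absurd this.symm hp
  · have h' := hg p
    rw [h, List.concat_eq_append] at h'
    obtain ⟨q, hq, -, hl⟩ := IsGeodesic.concat hg h'
    exact ⟨(q, a, p), ⟨hq, hl⟩, rfl⟩

/-- An edge and its inverse change the distance from the basepoint in opposite directions, so they
cannot both be ascending. -/
theorem positivePart_injOn_ascending :
    Set.InjOn LEdge.positivePart (ascending T g) := by
  rintro e ⟨-, he⟩ e' ⟨-, he'⟩ h
  rcases LEdge.eq_or_of_positivePart_eq h with h | h
  · exact h
  · subst h
    simp only at he
    omega

namespace IsSpanningTree

theorem positivePart_mem (hT : S.IsSpanningTree T) {e : LEdge A S.V} (he : e ∈ T) :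
    e.positivePart ∈ positive T := by
  refine ⟨?_, e.positivePart_positive⟩
  rcases e.positivePart_eq_or with h | h <;> rw [h]
  · exact he
  · exact hT.symm _ _ _ he

/-- In a spanning tree, distinct edges leading away from the basepoint have distinct targets, and
every edge or its inverse leads away from the basepoint. -/
theorem ascending_spec [Finite S.V] (hT : S.IsSpanningTree T)
    (hg : ∀ p, S.IsGeodesic T p (g p)) :
    Set.InjOn (fun e : LEdge A S.V => e.2.2) (ascending T g) ∧
      LEdge.positivePart '' ascending T g = positive T := by
  have h₁ : LEdge.positivePart '' ascending T g ⊆ positive T := by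
    rintro _ ⟨e, he, rfl⟩
    exact hT.positivePart_mem he.1
  have hc : (positive T).encard = ({S.base}ᶜ : Set S.V).encard := by
    have h := Set.encard_sdiff_singleton_add_one (Set.mem_univ S.base)
    rw [← Set.compl_eq_univ_sdiff, Set.encard_univ, ← hT.card] at h
    exact (WithTop.add_right_cancel ENat.one_ne_top h).symm
  have hfin : (positive T).Finite := by
    rw [← Set.encard_lt_top_iff, hc, Set.encard_lt_top_iff]
    exact Set.toFinite _
  have hDfin : (ascending T g).Finite :=
    Set.Finite.of_finite_image (hfin.subset h₁) positivePart_injOn_ascending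
  have hD : (LEdge.positivePart '' ascending T g).encard = (ascending T g).encard :=
    positivePart_injOn_ascending.encard_image
  -- With `m` vertices, `m - 1` ≤ number of targets ≤ number of ascending edges = number of their
  -- positive parts ≤ `m - 1`. Equality throughout makes the target map injective and the positive
  -- parts exhaust the tree.
  have h₂ := Set.encard_le_encard (compl_base_subset_target hg)
  have h₃ := Set.encard_image_le (fun e : LEdge A S.V => e.2.2) (ascending T g)
  have h₄ := Set.encard_le_encard h₁
  have h₅ : (ascending T g).encard ≤ ({S.base}ᶜ : Set S.V).encard := by rw [← hD, ← hc]; exact h₄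
  exact ⟨hDfin.injOn_of_encard_image_eq (le_antisymm h₃ (h₅.trans h₂)),
    (hfin.subset h₁).eq_of_subset_of_encard_le h₁ (by rw [hc, hD]; exact h₂.trans h₃)⟩

/-- The last edge of a geodesic is ascending, hence determined by its target; induction removes it
from both words. -/
theorem geodesic_unique [Finite S.V] (hT : S.IsSpanningTree T)
    (hg : ∀ p, S.IsGeodesic T p (g p)) {p : S.V} {w : Word A} (hw : S.IsGeodesic T p w) :
    w = g p := by
  have hinj := (hT.ascending_spec hg).1
  suffices ∀ (w : Word A) (p : S.V) (v : Word A), S.IsGeodesic T p w → S.IsGeodesic T p v → w = v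
    from this _ _ _ hw (hg p)
  intro w
  induction w using List.reverseRecOn with
  | nil =>
    intro p v h h'
    simpa using (h'.2 _ h.1)
  | append_singleton u a ih =>
    intro p v h h'
    rcases List.eq_nil_or_concat v with rfl | ⟨u', a', rfl⟩
    · simpa using h.2 _ h'.1
    · rw [List.concat_eq_append] at h' ⊢
      obtain ⟨q, hq, hu, hl⟩ := IsGeodesic.concat hg h
      obtain ⟨q', hq', hu', hl'⟩ := IsGeodesic.concat hg h'
      have := @hinj (q, a, p) ⟨hq, hl⟩ (q', a', p) ⟨hq', hl'⟩ rfl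
      obtain ⟨rfl, rfl, -⟩ := by simpa only [Prod.mk.injEq] using this
      rw [ih q u' hu hu']

theorem eq_concat_of_ascending [Finite S.V] (hT : S.IsSpanningTree T)
    (hg : ∀ p, S.IsGeodesic T p (g p)) {p q : S.V} {a : Letter A}
    (h : (p, a, q) ∈ ascending T g) : g q = g p ++ [a] := by
  have hl : (g q).length = (g p).length + 1 := h.2
  refine (hT.geodesic_unique hg ⟨IsPath.concat_iff.2 ⟨p, (hg p).1, h.1⟩, fun v hv => ?_⟩).symm
  have := (hg q).2 v hv
  simp only [List.length_append, List.length_singleton]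
  omega

/-- Geodesics to the endpoints of an edge of a spanning tree differ by that edge. -/
theorem geodesic_edge [Finite S.V] (hT : S.IsSpanningTree T)
    (hg : ∀ p, S.IsGeodesic T p (g p)) {p q : S.V} {a : Letter A} (h : (p, a, q) ∈ T) :
    g q = g p ++ [a] ∨ g p = g q ++ [Letter.inv a] := by
  obtain ⟨e, he, heq⟩ := (hT.ascending_spec hg).2.ge (hT.positivePart_mem h)
  rcases LEdge.eq_or_of_positivePart_eq heq with rfl | rfl
  · exact Or.inl (hT.eq_concat_of_ascending hg he)
  · exact Or.inr (hT.eq_concat_of_ascending hg he)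

theorem edgeElement_eq_one [Finite S.V] (hT : S.IsSpanningTree T)
    (hg : ∀ p, S.IsGeodesic T p (g p)) {e : LEdge A S.V} (h : e ∈ T) : edgeElement g e = 1 := by
  obtain ⟨p, a, q⟩ := e
  rcases hT.geodesic_edge hg h with h | h
  · simp only [edgeElement, h, ← FreeGroup.mul_mk]
    group
  · simp only [edgeElement, h, ← FreeGroup.mul_mk, mk_inv_singleton]
    group

/-- The elements attached to the positive edges outside a spanning tree generate. -/
theorem closure_edgeElement [Finite S.V] {X : Set (Word A)} {H : Subgroup (FreeGroup A)}
    (hS : S.Presents X H) (hX : Subgroup.closure (FreeGroup.mk '' X) = H)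
    (hT : S.IsSpanningTree T) (hg : ∀ p, S.IsGeodesic T p (g p)) :
    Subgroup.closure (edgeElement g '' (positive S.edges \ T)) = H := by
  apply le_antisymm
  · rw [Subgroup.closure_le]
    rintro _ ⟨⟨p, a, q⟩, ⟨⟨hE, -⟩, -⟩, rfl⟩
    have := (((hg p).1.mono hT.subset).append (IsPath.single_iff.2 hE)).append
      (((hg q).1.mono hT.subset).reverse S.involutive)
    have := hS.mk_mem this
    rwa [← FreeGroup.mul_mk, ← FreeGroup.mul_mk, ← FreeGroup.inv_mk] at this
  · rw [← hX, Subgroup.closure_le]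
    rintro _ ⟨x, hx, rfl⟩
    set K := Subgroup.closure (edgeElement g '' (positive S.edges \ T))
    have hpos : ∀ e ∈ S.edges, e.2.1.2 = true → edgeElement g e ∈ K := by
      intro e he ha
      by_cases h : e ∈ T
      · rw [hT.edgeElement_eq_one hg h]
        exact K.one_mem
      · exact Subgroup.subset_closure ⟨e, ⟨⟨he, ha⟩, h⟩, rfl⟩
    -- So `g` is a potential with respect to `K`, and since `g S.base` is empty, a loop reading `x`
    -- telescopes to `x` itself.
    have hE : ∀ p a q, (p, a, q) ∈ S.edges →
        FreeGroup.mk (g p) * FreeGroup.mk [a] * (FreeGroup.mk (g q))⁻¹ ∈ K := by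
      rintro p ⟨a, _ | _⟩ q he
      · have := K.inv_mem (hpos _ (S.involutive _ _ _ he) rfl)
        simp only [edgeElement, mk_inv_singleton] at this
        convert this using 1
        group
      · exact hpos _ he rfl
    have := (hS.loops x hx).telescope (fun p => FreeGroup.mk (g p)) hE
    simpa [IsGeodesic.base_eq_nil hg, ← FreeGroup.one_eq_mk] using this

theorem isFreeWithBasis [Finite S.V] {X : Set (Word A)} {H : Subgroup (FreeGroup A)}
    (hS : S.Presents X H) (hX : Subgroup.closure (FreeGroup.mk '' X) = H)
    (hdet : S.Deterministic) (hT : S.IsSpanningTree T) (hg : ∀ p, S.IsGeodesic T p (g p)) :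
    Set.InjOn (edgeElement g) (positive S.edges \ T) ∧
      IsFreeWithBasis H (edgeElement g '' (positive S.edges \ T)) := by
  have hinj := lift_edgeElement_injective hdet S.involutive hT.subset hT.symm g fun p => (hg p).1
  have hr : Set.range (fun e : ↥(positive S.edges \ T) => edgeElement g (e : LEdge A S.V)) =
      edgeElement g '' (positive S.edges \ T) := by
    rw [Set.image_eq_range]
  have := isFreeWithBasis_of_lift_injective _ hinj (H := H)
    (by rw [hr]; exact hT.closure_edgeElement hS hX hg)
  rw [hr] at this
  exact ⟨Set.injOn_iff_injective.2 this.1, this.2⟩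

end IsSpanningTree

/-- Breadth-first tree: every vertex except the basepoint chooses one ascending edge `par` ending
there. Following these edges back decreases the distance, whence connectedness, and their positive
parts are distinct, whence the count. -/
theorem exists_isSpanningTree (S : InvAutomaton A) (h : ∀ p, ∃ w, IsPath S.edges S.base w p) :
    ∃ T, S.IsSpanningTree T := by
  choose g hg using fun p => exists_geodesic (h p)
  have hasc : ∀ v : ↥({S.base}ᶜ : Set S.V), ∃ e ∈ ascending S.edges g, e.2.2 = v := fun v =>
    compl_base_subset_target hg v.2
  choose par hpar htgt using hasc
  let T : Set (LEdge A S.V) := {e | ∃ v,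
    e = par v ∨ e = ((par v).2.2, Letter.inv (par v).2.1, (par v).1)}
  have hsymm : ∀ p a q, (p, a, q) ∈ T → (q, Letter.inv a, p) ∈ T := by
    rintro p a q ⟨v, h | h⟩
    · exact ⟨v, Or.inr (by rw [← h])⟩
    · refine ⟨v, Or.inl ?_⟩
      simp only [Prod.mk.injEq] at h
      obtain ⟨rfl, rfl, rfl⟩ := h
      rw [Letter.inv_inv]
  have hreach : ∀ n p, (g p).length = n → ∃ w, IsPath T S.base w p := by
    intro n
    induction n with
    | zero =>
      intro p hp
      have := (hg p).1
      rw [List.length_eq_zero_iff.1 hp] at this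
      exact ⟨[], IsPath.nil_iff.2 (IsPath.nil_iff.1 this)⟩
    | succ n ih =>
      intro p hp
      have hpb : p ∈ ({S.base}ᶜ : Set S.V) := by
        rintro rfl
        rw [IsGeodesic.base_eq_nil (T := S.edges) hg] at hp
        simp at hp
      have h₁ := hpar ⟨p, hpb⟩
      have h₂ : (par ⟨p, hpb⟩).2.2 = p := htgt ⟨p, hpb⟩
      obtain ⟨w, hw⟩ := ih (par ⟨p, hpb⟩).1 (by have := h₁.2; rw [h₂] at this; omega)
      exact ⟨w ++ [(par ⟨p, hpb⟩).2.1], IsPath.concat_iff.2 ⟨_, hw, ⟨p, hpb⟩, 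
        Or.inl (Prod.ext rfl (Prod.ext rfl h₂.symm))⟩⟩
  have hpos : positive T = Set.range fun v => (par v).positivePart := by
    ext e
    constructor
    · rintro ⟨⟨v, h⟩, hs⟩
      refine ⟨v, ?_⟩
      simp only [LEdge.positivePart]
      rcases h with rfl | rfl
      · rw [if_pos hs]
      · rw [if_neg (by simpa [Letter.inv] using hs)]
    · rintro ⟨v, rfl⟩
      exact ⟨⟨v, (par v).positivePart_eq_or⟩, (par v).positivePart_positive⟩
  have hinj : Function.Injective fun v => (par v).positivePart := by
    intro v w h
    have := positivePart_injOn_ascending (hpar v) (hpar w) h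
    exact Subtype.ext (by rw [← htgt v, this, htgt w])
  refine ⟨T, ?_, hsymm, ?_, ?_⟩
  · rintro e ⟨v, rfl | rfl⟩
    · exact (hpar v).1
    · exact S.involutive _ _ _ (hpar v).1
  · rw [hpos, ← Set.image_univ, hinj.encard_image, Set.encard_univ, ENat.card_coe_set_eq, Set.compl_eq_univ_sdiff,
      Set.encard_sdiff_singleton_add_one (Set.mem_univ _), Set.encard_univ]
  · intro p q
    obtain ⟨v, hv⟩ := hreach _ p rfl
    obtain ⟨w, hw⟩ := hreach _ q rfl
    exact ⟨_, (hv.reverse hsymm).append hw⟩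

end InvAutomaton

/-! ### Reduction of paths in inverse automata -/

namespace IsPath

variable {A V : Type u} {E : Set (LEdge A V)} {p q r : V} {v w : Word A}

theorem unique (hdet : ∀ p a q r, (p, a, q) ∈ E → (p, a, r) ∈ E → q = r)
    (h : IsPath E p w q) (h' : IsPath E p w r) : q = r := by
  induction h with
  | nil => exact nil_iff.1 h'
  | cons h _ ih =>
    obtain ⟨s, hs, h'⟩ := cons_iff.1 h'
    obtain rfl := hdet _ _ _ _ h hs
    exact ih h'

/-- In an inverse automaton, paths may be reduced. -/
theorem red (hdet : ∀ p a q r, (p, a, q) ∈ E → (p, a, r) ∈ E → q = r)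
    (hinv : ∀ p a q, (p, a, q) ∈ E → (q, Letter.inv a, p) ∈ E)
    (h : IsPath E p v q) (hvw : FreeGroup.Red v w) : IsPath E p w q := by
  induction hvw with
  | refl => exact h
  | tail _ hs ih =>
    obtain ⟨⟩ := hs
    obtain ⟨s, h₁, h₂⟩ := append_iff.1 ih
    obtain ⟨t, ht, h₂⟩ := cons_iff.1 h₂
    obtain ⟨s', hs', h₂⟩ := cons_iff.1 h₂
    obtain rfl := hdet _ _ _ _ (hinv _ _ _ ht) hs'
    exact h₁.append h₂

end IsPath

/-! ### Finite certificates for inclusions of subgroups -/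

/-- `d` is a list of words from `L` and inverses of such words whose product is `m` in the free
group. -/
def IsFactorization {A : Type u} [DecidableEq A] (L : List (Word A)) (m : Word A)
    (d : List (Word A)) : Prop :=
  (∀ x ∈ d, x ∈ L ∨ FreeGroup.invRev x ∈ L) ∧ FreeGroup.reduce d.flatten = FreeGroup.reduce m

/-- The subset of the free group represented by a list of words. -/
def represented {A : Type u} (L : List (Word A)) : Set (FreeGroup A) :=
  {x | ∃ w ∈ L, FreeGroup.mk w = x}

section Factorization

variable {A : Type u} [DecidableEq A]

theorem mk_eq_mk_iff {v w : Word A} :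
    FreeGroup.mk v = FreeGroup.mk w ↔ FreeGroup.reduce v = FreeGroup.reduce w := by
  rw [← FreeGroup.toWord_inj, FreeGroup.toWord_mk, FreeGroup.toWord_mk]

theorem mk_reduce (w : Word A) : FreeGroup.mk (FreeGroup.reduce w) = FreeGroup.mk w :=
  FreeGroup.reduce.self

theorem IsFactorization.mk_mem {L : List (Word A)} {m : Word A} {d : List (Word A)}
    (h : IsFactorization L m d) : FreeGroup.mk m ∈ Subgroup.closure (represented L) := by
  obtain ⟨hd, hm⟩ := h
  rw [← mk_eq_mk_iff.2 hm]
  clear hm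
  induction d with
  | nil => simp [← FreeGroup.one_eq_mk]
  | cons x d ih =>
    rw [List.flatten_cons, ← FreeGroup.mul_mk]
    refine Subgroup.mul_mem _ ?_ (ih fun y hy => hd y (List.mem_cons_of_mem _ hy))
    rcases hd x List.mem_cons_self with h | h
    · exact Subgroup.subset_closure ⟨x, h, rfl⟩
    · rw [← Subgroup.inv_mem_iff, FreeGroup.inv_mk]
      exact Subgroup.subset_closure ⟨_, h, rfl⟩

theorem exists_isFactorization {L : List (Word A)} {m : Word A}
    (h : FreeGroup.mk m ∈ Subgroup.closure (represented L)) : ∃ d, IsFactorization L m d := by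
  suffices ∀ z ∈ Subgroup.closure (represented L), ∃ d : List (Word A),
      (∀ x ∈ d, x ∈ L ∨ FreeGroup.invRev x ∈ L) ∧ FreeGroup.mk d.flatten = z by
    obtain ⟨d, hd, hm⟩ := this _ h
    exact ⟨d, hd, mk_eq_mk_iff.1 hm⟩
  intro z hz
  induction hz using Subgroup.closure_induction with
  | mem z hz =>
    obtain ⟨w, hw, rfl⟩ := hz
    exact ⟨[w], by simpa using Or.inl hw, by simp⟩
  | one => exact ⟨[], by simp, by simp [FreeGroup.one_eq_mk]⟩
  | mul y z _ _ hy hz =>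
    obtain ⟨c, hc, rfl⟩ := hy
    obtain ⟨d, hd, rfl⟩ := hz
    refine ⟨c ++ d, fun x hx => ?_, by simp⟩
    rcases List.mem_append.1 hx with h | h
    exacts [hc x h, hd x h]
  | inv z hz' hz =>
    obtain ⟨d, hd, rfl⟩ := hz
    refine ⟨(d.map FreeGroup.invRev).reverse, fun x hx => ?_, ?_⟩
    · obtain ⟨y, hy, rfl⟩ := List.mem_map.1 (List.mem_reverse.1 hx)
      rw [FreeGroup.invRev_invRev]
      exact (hd y hy).symm
    · rw [FreeGroup.inv_mk]
      congr 1
      clear hd hz'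
      induction d with
      | nil => rfl
      | cons x d ih => simp [ih]

/-- `D` contains a factorization over `L` of every word in `M`. -/
def Factors (L M : List (Word A)) (D : List (List (Word A))) : Prop :=
  ∀ m ∈ M, ∃ d ∈ D, IsFactorization L m d

theorem Factors.closure_le {L M : List (Word A)} {D : List (List (Word A))} (h : Factors L M D) :
    Subgroup.closure (represented M) ≤ Subgroup.closure (represented L) := by
  rw [Subgroup.closure_le]
  rintro _ ⟨m, hm, rfl⟩
  obtain ⟨d, -, hd⟩ := h m hm
  exact hd.mk_mem

theorem Factors.mono {L M : List (Word A)} {D D' : List (List (Word A))} (h : Factors L M D)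
    (hD : D ⊆ D') : Factors L M D' := fun m hm =>
  let ⟨d, hd, h⟩ := h m hm
  ⟨d, hD hd, h⟩

/-- Completeness of the certificates; `Factors.closure_le` is their soundness. -/
theorem exists_factors {L M : List (Word A)}
    (h : Subgroup.closure (represented M) ≤ Subgroup.closure (represented L)) :
    ∃ D, Factors L M D := by
  have : ∀ m ∈ M, ∃ d, IsFactorization L m d := fun m hm =>
    exists_isFactorization (h (Subgroup.subset_closure ⟨m, hm, rfl⟩))
  choose! f hf using this
  exact ⟨M.map f, fun m hm => ⟨f m, List.mem_map_of_mem hm, hf m hm⟩⟩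

end Factorization

/-! ### Schreier data: automata with words as vertices -/

/-- `P` is a finite prefix-closed set of reduced words, viewed as a tree, and `N` a list of
positively labelled edges between words in `P` which together with the tree form an inverse
automaton. -/
structure IsSchreierData {A : Type u} [DecidableEq A] (P : List (Word A))
    (N : List (LEdge A (Word A))) : Prop where
  nil_mem : [] ∈ P
  dropLast_mem : ∀ w ∈ P, w.dropLast ∈ P
  reduced : ∀ w ∈ P, FreeGroup.reduce w = w
  edge : ∀ e ∈ N, e.1 ∈ P ∧ e.2.2 ∈ P ∧ e.2.1.2 = true ∧
    FreeGroup.reduce (e.1 ++ [e.2.1]) ∉ P ∧ FreeGroup.reduce (e.2.2 ++ [Letter.inv e.2.1]) ∉ P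
  biunique : ∀ e ∈ N, ∀ e' ∈ N, e.2.1 = e'.2.1 → (e.1 = e'.1 ↔ e.2.2 = e'.2.2)

/-- In this form the condition is visibly built from bounded quantifiers over lists, as the
primitive recursive check requires. -/
theorem isSchreierData_iff {A : Type u} [DecidableEq A] {P : List (Word A)}
    {N : List (LEdge A (Word A))} :
    IsSchreierData P N ↔ [] ∈ P ∧ (∀ w ∈ P, w.dropLast ∈ P) ∧ (∀ w ∈ P, FreeGroup.reduce w = w) ∧
      (∀ e ∈ N, e.1 ∈ P ∧ e.2.2 ∈ P ∧ e.2.1.2 = true ∧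
        FreeGroup.reduce (e.1 ++ [e.2.1]) ∉ P ∧
        FreeGroup.reduce (e.2.2 ++ [Letter.inv e.2.1]) ∉ P) ∧
      ∀ e ∈ N, ∀ e' ∈ N, e.2.1 = e'.2.1 → (e.1 = e'.1 ↔ e.2.2 = e'.2.2) :=
  ⟨fun h => ⟨h.1, h.2, h.3, h.4, h.5⟩, fun ⟨h₁, h₂, h₃, h₄, h₅⟩ => ⟨h₁, h₂, h₃, h₄, h₅⟩⟩

/-- The reduced word representing the element attached to an edge between words. -/
def edgeWord {A : Type u} [DecidableEq A] (e : LEdge A (Word A)) : Word A :=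
  FreeGroup.reduce (e.1 ++ e.2.1 :: FreeGroup.invRev e.2.2)

theorem mk_edgeWord {A : Type u} [DecidableEq A] (e : LEdge A (Word A)) :
    FreeGroup.mk (edgeWord e) = edgeElement id e := by
  rw [edgeWord, mk_reduce, ← FreeGroup.mul_mk, mk_cons, edgeElement, FreeGroup.inv_mk, mul_assoc]
  rfl

/-- The reduced words representing the elements attached to a list of edges, without repetition. -/
def edgeWords {A : Type u} [DecidableEq A] (N : List (LEdge A (Word A))) : List (Word A) :=
  (N.map edgeWord).dedup

theorem represented_edgeWords {A : Type u} [DecidableEq A] (N : List (LEdge A (Word A))) :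
    represented (edgeWords N) = edgeElement id '' {e | e ∈ N} := by
  ext x
  constructor
  · rintro ⟨w, hw, rfl⟩
    obtain ⟨e, he, rfl⟩ := List.mem_map.1 (List.mem_dedup.1 hw)
    exact ⟨e, he, (mk_edgeWord e).symm⟩
  · rintro ⟨e, he, rfl⟩
    exact ⟨_, List.mem_dedup.2 (List.mem_map_of_mem he), mk_edgeWord e⟩

namespace IsSchreierData

variable {A : Type u} [DecidableEq A] {P : List (Word A)} {N : List (LEdge A (Word A))}

/-- The elements attached to the edges in Schreier data form a basis of the subgroup that they
generate. -/
theorem isFreeWithBasis (h : IsSchreierData P N) :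
    IsFreeWithBasis (Subgroup.closure (represented (edgeWords N))) (represented (edgeWords N)) := by
  let V := {w : Word A // w ∈ P}
  -- The edges of the Cayley graph of `F_A` between vertices in `P`.
  let T : Set (LEdge A V) :=
    {e | FreeGroup.mk e.1.1 * FreeGroup.mk [e.2.1] = FreeGroup.mk e.2.2.1}
  let E : Set (LEdge A V) := {e | e ∈ T ∨ mapEdge Subtype.val e ∈ N ∨
    mapEdge Subtype.val (e.2.2, Letter.inv e.2.1, e.1) ∈ N}
  have hmk : ∀ p q : V, FreeGroup.mk p.1 = FreeGroup.mk q.1 → p = q := fun p q hpq => by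
    rw [mk_eq_mk_iff, h.reduced _ p.2, h.reduced _ q.2] at hpq
    exact Subtype.ext hpq
  have hTinv : ∀ p a q, (p, a, q) ∈ T → (q, Letter.inv a, p) ∈ T := by
    intro p a q (hT : _ = _)
    change _ = _
    rw [mk_inv_singleton, ← hT, mul_inv_cancel_right]
  have hinv : ∀ p a q, (p, a, q) ∈ E → (q, Letter.inv a, p) ∈ E := by
    rintro p a q (h | h | h)
    · exact Or.inl (hTinv _ _ _ h)
    · exact Or.inr (Or.inr (by rwa [Letter.inv_inv]))
    · exact Or.inr (Or.inl h)
  have hTN : ∀ p a q q', (p, a, q) ∈ T → mapEdge Subtype.val ((p, a, q') : LEdge A V) ∉ N := by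
    intro p a q q' (hT : _ = _) hN
    rw [FreeGroup.mul_mk, mk_eq_mk_iff, h.reduced _ q.2] at hT
    exact (h.edge _ hN).2.2.2.1 (hT ▸ q.2)
  have hTN' : ∀ p a q q', (p, a, q) ∈ T →
      mapEdge Subtype.val ((q', Letter.inv a, p) : LEdge A V) ∉ N := by
    intro p a q q' (hT : _ = _) hN
    rw [FreeGroup.mul_mk, mk_eq_mk_iff, h.reduced _ q.2] at hT
    have := (h.edge _ hN).2.2.2.2
    simp only [mapEdge, Letter.inv_inv] at this
    exact this (hT ▸ q.2)
  have hNN : ∀ p a q q' r, mapEdge Subtype.val ((p, a, q) : LEdge A V) ∈ N →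
      mapEdge Subtype.val ((q', Letter.inv a, r) : LEdge A V) ∉ N := by
    intro p a q q' r hN hN'
    have h₁ := (h.edge _ hN).2.2.1
    have h₂ := (h.edge _ hN').2.2.1
    simp only [mapEdge] at h₁ h₂
    simp [Letter.inv, h₁] at h₂
  -- Two tree edges agree because reduced words are unique; a tree edge never competes with one from
  -- `N` or its inverse, since the latter lead out of `P` in the Cayley graph; an edge of `N` and an
  -- inverse one have labels of opposite sign; the rest is `biunique`.
  have hdet : ∀ p a q r, (p, a, q) ∈ E → (p, a, r) ∈ E → q = r := by
    rintro p a q r (h₁ | h₁ | h₁) (h₂ | h₂ | h₂)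
    · exact hmk _ _ (h₁.symm.trans h₂)
    · exact absurd h₂ (hTN _ _ _ _ h₁)
    · exact absurd h₂ (hTN' _ _ _ _ h₁)
    · exact absurd h₁ (hTN _ _ _ _ h₂)
    · exact Subtype.ext ((h.biunique _ h₁ _ h₂ rfl).1 rfl)
    · exact absurd h₂ (hNN _ _ _ _ _ h₁)
    · exact absurd h₁ (hTN' _ _ _ _ h₂)
    · exact absurd h₁ (hNN _ _ _ _ _ h₂)
    · exact Subtype.ext ((h.biunique _ h₁ _ h₂ rfl).2 rfl)
  -- By prefix-closedness every vertex is its own access word, so the inclusion of `P` can play the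
  -- role of `g`.
  have hpath : ∀ (w : Word A) (hw : w ∈ P), IsPath T ⟨[], h.nil_mem⟩ w ⟨w, hw⟩ := by
    intro w
    induction w using List.reverseRecOn with
    | nil => exact fun _ => .nil _
    | append_singleton u a ih =>
      intro hw
      have hu : u ∈ P := by simpa using h.dropLast_mem _ hw
      exact IsPath.concat_iff.2 ⟨⟨u, hu⟩, ih hu, FreeGroup.mul_mk⟩
  have hI : positive E \ T = {e | mapEdge Subtype.val e ∈ N} := by
    ext e
    constructor
    · rintro ⟨⟨hT | hN | hN, hs⟩, hnT⟩
      · exact absurd hT hnT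
      · exact hN
      · have := (h.edge _ hN).2.2.1
        simp [mapEdge, Letter.inv, hs] at this
    · intro hN
      exact ⟨⟨Or.inr (Or.inl hN), (h.edge _ hN).2.2.1⟩, fun hT => hTN _ _ _ _ hT hN⟩
  have hr : Set.range (fun e : ↥(positive E \ T) => edgeElement Subtype.val (e : LEdge A V)) =
      represented (edgeWords N) := by
    rw [← Set.image_eq_range, hI, represented_edgeWords]
    ext x
    constructor
    · rintro ⟨e, he, rfl⟩
      exact ⟨_, he, rfl⟩
    · rintro ⟨e, he, rfl⟩
      have := h.edge e he
      exact ⟨(⟨e.1, this.1⟩, e.2.1, ⟨e.2.2, this.2.1⟩), he, rfl⟩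
  have : Finite V := P.finite_toSet
  have := isFreeWithBasis_of_lift_injective _
    (lift_edgeElement_injective hdet hinv (fun e he => Or.inl he) hTinv Subtype.val
      fun p => hpath p.1 p.2) rfl
  rw [hr] at this
  exact this.2

end IsSchreierData

/-- Every finitely generated subgroup of a free group of finite rank is generated by the elements
attached to some Schreier data. -/
theorem exists_isSchreierData {A : Type u} [Finite A] [DecidableEq A] {H : Subgroup (FreeGroup A)}
    (hH : H.FG) : ∃ P N, IsSchreierData P N ∧
      Subgroup.closure (represented (edgeWords (A := A) N)) = H := by
  obtain ⟨S, hS⟩ := exists_isStallingsOf hH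
  obtain ⟨⟨hdet, -⟩, X, hpres, hX⟩ := hS.presents
  obtain ⟨T, hT⟩ := exists_isSpanningTree S hpres.reach
  choose g hg using fun p => exists_geodesic (hT.connected S.base p)
  have := hpres.finite
  have hTdet : ∀ p a q r, (p, a, q) ∈ T → (p, a, r) ∈ T → q = r := fun p a q r h h' =>
    hdet _ _ _ _ (hT.subset h) (hT.subset h')
  have hP := (Set.finite_range g).exists_finset_coe
  have hN := (Set.toFinite (mapEdge g '' (positive S.edges \ T))).exists_finset_coe
  obtain ⟨P, hP⟩ := hP
  obtain ⟨N, hN⟩ := hN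
  replace hP : ∀ w, w ∈ P.toList ↔ ∃ p, g p = w := fun w => by
    rw [Finset.mem_toList, ← Finset.mem_coe, hP]; rfl
  replace hN : ∀ e, e ∈ N.toList ↔ e ∈ mapEdge g '' (positive S.edges \ T) := fun e => by
    rw [Finset.mem_toList, ← Finset.mem_coe, hN]
  -- Each vertex is renamed by its geodesic. Determinism makes the names distinct; they are reduced,
  -- since reducing would shorten the path.
  have hinj : Function.Injective g := fun p q h =>
    IsPath.unique hTdet (hg p).1 (h ▸ (hg q).1)
  have hred : ∀ p, FreeGroup.reduce (g p) = g p := fun p =>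
    FreeGroup.reduce.red.sublist.eq_of_length_le
      ((hg p).2 _ ((hg p).1.red hTdet hT.symm FreeGroup.reduce.red))
  -- If `g_p a` reduced to `g_r`, then `g_p⁻¹ g_r`, which labels a path from `p` to `r` in `T`,
  -- would reduce to `a`. Reducing the path puts `(p, a, r)` into `T`, and determinism gives `r =
  -- q`.
  have hout : ∀ p a q r, (p, a, q) ∈ S.edges → (p, a, q) ∉ T →
      FreeGroup.reduce (g p ++ [a]) ≠ g r := by
    intro p a q r hE hnT h
    have h₁ : FreeGroup.mk (FreeGroup.invRev (g p) ++ g r) = FreeGroup.mk [a] := by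
      rw [← h, ← FreeGroup.mul_mk, mk_reduce, ← FreeGroup.mul_mk, ← FreeGroup.inv_mk]
      group
    have h₂ : FreeGroup.Red (FreeGroup.invRev (g p) ++ g r) [a] := by
      have := FreeGroup.reduce.red (L := FreeGroup.invRev (g p) ++ g r)
      rwa [mk_eq_mk_iff.1 h₁, FreeGroup.reduce_singleton] at this
    have h₃ := (((hg p).1.reverse hT.symm).append (hg r).1).red hTdet hT.symm h₂
    rw [IsPath.single_iff] at h₃
    exact hnT (hdet _ _ _ _ hE (hT.subset h₃) ▸ h₃)
  refine ⟨P.toList, N.toList, ⟨?_, ?_, ?_, ?_, ?_⟩, ?_⟩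
  · exact (hP _).2 ⟨S.base, IsGeodesic.base_eq_nil hg⟩
  · intro w hw
    obtain ⟨p, rfl⟩ := (hP w).1 hw
    rcases List.eq_nil_or_concat (g p) with h | ⟨u, a, h⟩
    · rw [h]; rw [h] at hw; exact hw
    · rw [List.concat_eq_append] at h
      have h' := hg p
      rw [h] at h'
      obtain ⟨q, -, hq, -⟩ := IsGeodesic.concat hg h'
      rw [h, List.dropLast_concat, hT.geodesic_unique hg hq]
      exact (hP _).2 ⟨q, rfl⟩
  · intro w hw
    obtain ⟨p, rfl⟩ := (hP w).1 hw
    exact hred p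
  · intro e he
    obtain ⟨⟨p, a, q⟩, ⟨⟨hE, hs⟩, hnT⟩, rfl⟩ := (hN e).1 he
    refine ⟨(hP _).2 ⟨p, rfl⟩, (hP _).2 ⟨q, rfl⟩, hs, fun h => ?_, fun h => ?_⟩
    · obtain ⟨r, hr⟩ := (hP _).1 h
      exact hout _ _ _ r hE hnT hr.symm
    · obtain ⟨r, hr⟩ := (hP _).1 h
      refine hout _ _ _ r (S.involutive _ _ _ hE) (fun h' => hnT ?_) hr.symm
      have := hT.symm _ _ _ h'
      rwa [Letter.inv_inv] at this
  · intro e he e' he' ha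
    obtain ⟨⟨p, a, q⟩, ⟨⟨hE, -⟩, -⟩, rfl⟩ := (hN e).1 he
    obtain ⟨⟨p', a', q'⟩, ⟨⟨hE', -⟩, -⟩, rfl⟩ := (hN e').1 he'
    obtain rfl : a = a' := ha
    refine ⟨fun h => ?_, fun h => ?_⟩
    · obtain rfl := hinj h
      exact congrArg g (hdet _ _ _ _ hE hE')
    · obtain rfl := hinj h
      exact congrArg g (hdet _ _ _ _ (S.involutive _ _ _ hE) (S.involutive _ _ _ hE'))
  · rw [represented_edgeWords, ← hT.closure_edgeElement hpres hX hg]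
    congr 1
    ext x
    constructor
    · rintro ⟨_, he', rfl⟩
      obtain ⟨e, he, rfl⟩ := (hN _).1 he'
      exact ⟨e, he, rfl⟩
    · rintro ⟨e, he, rfl⟩
      exact ⟨_, (hN _).2 ⟨e, he, rfl⟩, rfl⟩

/-! ### Unbounded search and primitive recursive tools -/

section Search

variable {α β : Type*} [Primcodable α] [Primcodable β]

/-- Unbounded search for a witness of a primitive recursive relation is computable. -/
theorem exists_computable_of_primrecRel {R : α → β → Prop} (hR : PrimrecRel R)
    (h : ∀ a, ∃ b, R a b) : ∃ f : α → β, Computable f ∧ ∀ a, R a (f a) := by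
  classical
  -- Stage `n` decodes `n` as a candidate and returns it only if it passes the test.
  let s : α → ℕ → Option β := fun a n =>
    (Encodable.decode n : Option β).bind fun b => if R a b then some b else none
  have hs : Primrec₂ s := by
    refine Primrec.option_bind (Primrec.decode.comp Primrec.snd) ?_
    exact Primrec.ite (hR.comp (Primrec.fst.comp Primrec.fst) Primrec.snd)
      (Primrec.option_some.comp Primrec.snd) (Primrec.const none)
  have hspec : ∀ a b n, b ∈ s a n → R a b := by
    intro a b n hb
    obtain ⟨c, -, hc⟩ := Option.bind_eq_some_iff.1 hb
    split_ifs at hc with hR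
    · cases hc
      exact hR
  have hdom : ∀ a, (Nat.rfindOpt (s a)).Dom := fun a => by
    obtain ⟨b, hb⟩ := h a
    exact Nat.rfindOpt_dom.2 ⟨Encodable.encode b, b, by simp [s, hb]⟩
  refine ⟨fun a => (Nat.rfindOpt (s a)).get (hdom a),
    Partrec.of_eq_tot (Partrec.rfindOpt hs.to_comp) fun a => Part.get_mem _, fun a => ?_⟩
  obtain ⟨n, hn⟩ := Nat.rfindOpt_spec (Part.get_mem (hdom a))
  exact hspec _ _ _ hn

theorem primrecPred_forall_mem {f : α → List β} (hf : Primrec f) {R : α → β → Prop}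
    (hR : PrimrecRel R) : PrimrecPred fun a => ∀ b ∈ f a, R a b :=
  PrimrecRel.comp (PrimrecRel.forall_mem_list (R := fun b a => R a b)
    (hR.comp Primrec.snd Primrec.fst)) hf Primrec.id

theorem primrecPred_exists_mem {f : α → List β} (hf : Primrec f) {R : α → β → Prop}
    (hR : PrimrecRel R) : PrimrecPred fun a => ∃ b ∈ f a, R a b :=
  PrimrecRel.comp (PrimrecRel.exists_mem_list (R := fun b a => R a b)
    (hR.comp Primrec.snd Primrec.fst)) hf Primrec.id

theorem primrecRel_mem : PrimrecRel fun (b : β) (l : List β) => b ∈ l :=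
  (primrecPred_exists_mem (f := fun p : β × List β => p.2) (R := fun p b => b = p.1) Primrec.snd
    (Primrec.eq.comp Primrec.snd (Primrec.fst.comp Primrec.fst))).of_eq fun p => by simp

theorem primrecPred_imp {p q : α → Prop} (hp : PrimrecPred p) (hq : PrimrecPred q) :
    PrimrecPred fun a => p a → q a :=
  (hp.not.or hq).of_eq fun _ => imp_iff_not_or.symm

theorem primrecPred_iff {p q : α → Prop} (hp : PrimrecPred p) (hq : PrimrecPred q) :
    PrimrecPred fun a => p a ↔ q a :=
  ((primrecPred_imp hp hq).and (primrecPred_imp hq hp)).of_eq fun _ => iff_def.symm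

theorem primrec_dropLast : Primrec (List.dropLast : List α → List α) :=
  (Primrec.list_reverse.comp (Primrec.list_tail.comp Primrec.list_reverse)).of_eq fun l => by
    simp [List.tail_reverse]

theorem primrec_dedup [DecidableEq α] : Primrec (List.dedup : List α → List α) := by
  have : Primrec fun l : List α =>
      l.foldr (fun a acc => if a ∈ acc then acc else a :: acc) [] := by
    refine Primrec.list_foldr (g := fun _ => ([] : List α))
      (h := fun _ p => if p.1 ∈ p.2 then p.2 else p.1 :: p.2) Primrec.id (Primrec.const []) ?_
    exact Primrec.ite
      (primrecRel_mem.comp (Primrec.fst.comp Primrec.snd) (Primrec.snd.comp Primrec.snd))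
      (Primrec.snd.comp Primrec.snd)
      (Primrec.list_cons.comp (Primrec.fst.comp Primrec.snd) (Primrec.snd.comp Primrec.snd))
  refine this.of_eq fun l => ?_
  induction l with
  | nil => rfl
  | cons a l ih =>
    rw [List.foldr_cons, ih]
    split_ifs with h
    · rw [List.dedup_cons_of_mem' h]
    · rw [List.dedup_cons_of_notMem' h]

end Search

/-! ### Primitive recursiveness of the word operations and of the checks -/

section Words

variable {A : Type u} [Primcodable A]

theorem primrec_letter_inv : Primrec (Letter.inv : Letter A → Letter A) :=
  Primrec.pair Primrec.fst (Primrec.not.comp Primrec.snd)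

theorem primrec_invRev : Primrec (FreeGroup.invRev : Word A → Word A) :=
  Primrec.list_reverse.comp
    (Primrec.list_map Primrec.id (primrec_letter_inv.comp Primrec.snd).to₂)

variable [DecidableEq A]

/-- Free reduction is a right fold: a letter put before a reduced word either cancels its head or is
prepended. -/
theorem primrec_reduce : Primrec (FreeGroup.reduce : Word A → Word A) := by
  have hstep : Primrec₂ fun (_ : Word A) (p : Letter A × Word A) =>
      (List.casesOn p.2 [p.1] fun b t =>
        if p.1.1 = b.1 ∧ p.1.2 = !b.2 then t else p.1 :: b :: t : Word A) := by
    refine Primrec.list_casesOn (f := fun p : Word A × Letter A × Word A => p.2.2)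
      (g := fun p => ([p.2.1] : Word A))
      (h := fun p q => if p.2.1.1 = q.1.1 ∧ p.2.1.2 = !q.1.2 then q.2 else p.2.1 :: q.1 :: q.2)
      (Primrec.snd.comp Primrec.snd)
      (Primrec.list_cons.comp (Primrec.fst.comp Primrec.snd) (Primrec.const [])) ?_
    have ha : Primrec fun q : (Word A × Letter A × Word A) × Letter A × Word A => q.1.2.1 :=
      Primrec.fst.comp (Primrec.snd.comp Primrec.fst)
    have hb : Primrec fun q : (Word A × Letter A × Word A) × Letter A × Word A => q.2.1 :=
      Primrec.fst.comp Primrec.snd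
    have ht : Primrec fun q : (Word A × Letter A × Word A) × Letter A × Word A => q.2.2 :=
      Primrec.snd.comp Primrec.snd
    exact Primrec.ite
      ((Primrec.eq.comp (Primrec.fst.comp ha) (Primrec.fst.comp hb)).and
        (Primrec.eq.comp (Primrec.snd.comp ha) (Primrec.not.comp (Primrec.snd.comp hb))))
      ht (Primrec.list_cons.comp ha (Primrec.list_cons.comp hb ht))
  refine (Primrec.list_foldr Primrec.id (Primrec.const ([] : Word A)) hstep).of_eq fun w => ?_
  induction w with
  | nil => rfl
  | cons a w ih =>
    rw [FreeGroup.reduce.cons, ← ih]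
    rfl

theorem primrec_edgeWord : Primrec (edgeWord : LEdge A (Word A) → Word A) :=
  primrec_reduce.comp (Primrec.list_append.comp Primrec.fst (Primrec.list_cons.comp
    (Primrec.fst.comp Primrec.snd) (primrec_invRev.comp (Primrec.snd.comp Primrec.snd))))

theorem primrec_edgeWords : Primrec (edgeWords : List (LEdge A (Word A)) → List (Word A)) :=
  primrec_dedup.comp (Primrec.list_map Primrec.id (primrec_edgeWord.comp Primrec.snd).to₂)

theorem primrecPred_factors {α : Type*} [Primcodable α] {L M : α → List (Word A)}
    {D : α → List (List (Word A))} (hL : Primrec L) (hM : Primrec M) (hD : Primrec D) :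
    PrimrecPred fun a => Factors (L a) (M a) (D a) := by
  refine primrecPred_forall_mem hM
    (primrecPred_exists_mem (hD.comp Primrec.fst) (PrimrecPred.and ?_ ?_))
  · have hL' : Primrec fun q : ((α × Word A) × List (Word A)) × Word A => L q.1.1.1 :=
      hL.comp (Primrec.fst.comp (Primrec.fst.comp Primrec.fst))
    exact primrecPred_forall_mem Primrec.snd
      ((primrecRel_mem.comp Primrec.snd hL').or
        (primrecRel_mem.comp (primrec_invRev.comp Primrec.snd) hL'))
  · exact Primrec.eq.comp (primrec_reduce.comp (Primrec.list_flatten.comp Primrec.snd))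
      (primrec_reduce.comp (Primrec.snd.comp Primrec.fst))

theorem primrecPred_isSchreierData {α : Type*} [Primcodable α] {P : α → List (Word A)}
    {N : α → List (LEdge A (Word A))} (hP : Primrec P) (hN : Primrec N) :
    PrimrecPred fun a => IsSchreierData (P a) (N a) := by
  refine PrimrecPred.of_eq (PrimrecPred.and ?_ (PrimrecPred.and ?_ (PrimrecPred.and ?_
    (PrimrecPred.and ?_ ?_)))) fun a => isSchreierData_iff.symm
  · exact primrecRel_mem.comp (Primrec.const []) hP
  · exact primrecPred_forall_mem hP
      (primrecRel_mem.comp (primrec_dropLast.comp Primrec.snd) (hP.comp Primrec.fst))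
  · exact primrecPred_forall_mem hP
      (Primrec.eq.comp (primrec_reduce.comp Primrec.snd) Primrec.snd)
  · have hP' : Primrec fun q : α × LEdge A (Word A) => P q.1 := hP.comp Primrec.fst
    have h₁ : Primrec fun q : α × LEdge A (Word A) => q.2.1 := Primrec.fst.comp Primrec.snd
    have h₂ : Primrec fun q : α × LEdge A (Word A) => q.2.2.1 :=
      Primrec.fst.comp (Primrec.snd.comp Primrec.snd)
    have h₃ : Primrec fun q : α × LEdge A (Word A) => q.2.2.2 :=
      Primrec.snd.comp (Primrec.snd.comp Primrec.snd)
    refine primrecPred_forall_mem hN (PrimrecPred.and (primrecRel_mem.comp h₁ hP')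
      (PrimrecPred.and (primrecRel_mem.comp h₃ hP') (PrimrecPred.and
        (Primrec.eq.comp (Primrec.snd.comp h₂) (Primrec.const true)) (PrimrecPred.and ?_ ?_))))
    · exact (primrecRel_mem.comp
        (primrec_reduce.comp (Primrec.list_concat.comp h₁ h₂)) hP').not
    · exact (primrecRel_mem.comp
        (primrec_reduce.comp (Primrec.list_concat.comp h₃ (primrec_letter_inv.comp h₂))) hP').not
  · refine primrecPred_forall_mem hN (primrecPred_forall_mem (hN.comp Primrec.fst) ?_)
    have h : Primrec fun q : (α × LEdge A (Word A)) × LEdge A (Word A) => q.1.2 :=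
      Primrec.snd.comp Primrec.fst
    have h' : Primrec fun q : (α × LEdge A (Word A)) × LEdge A (Word A) => q.2 := Primrec.snd
    exact primrecPred_imp
      (Primrec.eq.comp (Primrec.fst.comp (Primrec.snd.comp h))
        (Primrec.fst.comp (Primrec.snd.comp h')))
      (primrecPred_iff (Primrec.eq.comp (Primrec.fst.comp h) (Primrec.fst.comp h'))
        (Primrec.eq.comp (Primrec.snd.comp (Primrec.snd.comp h))
          (Primrec.snd.comp (Primrec.snd.comp h'))))

end Words

/-! ### The effective theorem and the final assembly -/

/-- **Effective Nielsen–Schreier theorem** for finitely generated subgroups. -/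
theorem exists_computable_basis {A : Type u} [Finite A] [Primcodable A] :
    ∃ f : List (Word A) → List (Word A), Computable f ∧ ∀ L : List (Word A),
      (∀ w ∈ f L, FreeGroup.IsReduced w) ∧ (f L).Nodup ∧
        IsFreeWithBasis (Subgroup.closure (represented L)) (represented (f L)) := by
  classical
  -- A candidate is a triple `(P, N, D)`. The single list `D` holds the factorizations for both
  -- inclusions, so existence uses the concatenation of two lists.
  let R : List (Word A) →
      List (Word A) × List (LEdge A (Word A)) × List (List (Word A)) → Prop := fun L c =>
    IsSchreierData c.1 c.2.1 ∧ Factors L (edgeWords c.2.1) c.2.2 ∧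
      Factors (edgeWords c.2.1) L c.2.2
  have hR : PrimrecRel R := by
    have hN : Primrec fun q : List (Word A) ×
        List (Word A) × List (LEdge A (Word A)) × List (List (Word A)) => q.2.2.1 :=
      Primrec.fst.comp (Primrec.snd.comp Primrec.snd)
    have hD : Primrec fun q : List (Word A) ×
        List (Word A) × List (LEdge A (Word A)) × List (List (Word A)) => q.2.2.2 :=
      Primrec.snd.comp (Primrec.snd.comp Primrec.snd)
    exact (primrecPred_isSchreierData (Primrec.fst.comp Primrec.snd) hN).and
      ((primrecPred_factors Primrec.fst (primrec_edgeWords.comp hN) hD).and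
        (primrecPred_factors (primrec_edgeWords.comp hN) Primrec.fst hD))
  have hex : ∀ L, ∃ c, R L c := by
    intro L
    have hfin : (represented L).Finite :=
      (L.finite_toSet.image FreeGroup.mk).subset fun x ⟨w, hw, h⟩ => ⟨w, hw, h⟩
    obtain ⟨P, N, hPN, hcl⟩ := exists_isSchreierData
      ((Subgroup.fg_iff _).2 ⟨represented L, rfl, hfin⟩)
    obtain ⟨D, hD⟩ := exists_factors hcl.le
    obtain ⟨D', hD'⟩ := exists_factors hcl.ge
    exact ⟨(P, N, D ++ D'), hPN, hD.mono (List.subset_append_left _ _),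
      hD'.mono (List.subset_append_right _ _)⟩
  obtain ⟨c, hc, hcR⟩ := exists_computable_of_primrecRel hR hex
  refine ⟨fun L => edgeWords (c L).2.1,
    primrec_edgeWords.to_comp.comp (Computable.fst.comp (Computable.snd.comp hc)), fun L => ?_⟩
  obtain ⟨hPN, hD, hD'⟩ := hcR L
  refine ⟨fun w hw => ?_, List.nodup_dedup _, ?_⟩
  · obtain ⟨e, -, rfl⟩ := List.mem_map.1 (List.mem_dedup.1 hw)
    rw [edgeWord, ← FreeGroup.toWord_mk]
    exact FreeGroup.isReduced_toWord
  · rw [le_antisymm hD'.closure_le hD.closure_le]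
    exact hPN.isFreeWithBasis

end Stallings

theorem mainTheorem4 {A : Type u} [Finite A] :
    (∀ H : Subgroup (FreeGroup A), H.FG →
      (∃ S : Stallings.InvAutomaton A, S.IsStallingsOf H) ∧
      ∀ S : Stallings.InvAutomaton A, S.IsStallingsOf H →
        (∃ T, S.IsSpanningTree T) ∧
        ∀ T, S.IsSpanningTree T →
          ∀ g : S.V → Stallings.Word A, (∀ p, S.IsGeodesic T p (g p)) →
            Set.InjOn (Stallings.InvAutomaton.edgeElement g)
              (Stallings.InvAutomaton.positive S.edges \ T) ∧
            Stallings.IsFreeWithBasis H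
              (Stallings.InvAutomaton.edgeElement g ''
                (Stallings.InvAutomaton.positive S.edges \ T))) ∧
    (∀ [Primcodable A], ∃ f : List (Stallings.Word A) → List (Stallings.Word A),
      Computable f ∧
      ∀ L : List (Stallings.Word A),
        (∀ w ∈ f L, FreeGroup.IsReduced w) ∧ (f L).Nodup ∧
        Stallings.IsFreeWithBasis (Subgroup.closure {x | ∃ w ∈ L, FreeGroup.mk w = x})
          {y | ∃ w ∈ f L, FreeGroup.mk w = y}) := by
  refine ⟨fun H hH => ⟨Stallings.InvAutomaton.exists_isStallingsOf hH, fun S hS => ?_⟩,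
    Stallings.exists_computable_basis⟩
  obtain ⟨⟨hdet, -⟩, X, hpres, hX⟩ := hS.presents
  have := hpres.finite
  exact ⟨Stallings.InvAutomaton.exists_isSpanningTree S hpres.reach,
    fun T hT g hg => hT.isFreeWithBasis hpres hX hdet hg⟩
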